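/- Let $A\in\mathbb{R}^{N\times N}$ be a symmetric matrix with spectral radius $\rho(A)<1$, and consider the linear dynamical system $$x_0=0,\qquad x_t=Ax_{t-1}+\xi_{t-1}\quad(t\ge 1),$$ where $\xi_0,\xi_1,\dots$ are i.i.d. Gaussian random vectors in $\mathbb{R}^N$ with $\mathbb{E}[\xi_t]=0$ and $\mathbb{E}[\xi_t\xi_t^\top]=\sigma^2 I$. For integers $m\ge 0$ and $T\ge m+3$ define the estimator $$\hat{\mathbb{S}}_m(T)=\frac{1}{T-m}\sum_{t=0}^{T-m-1}x_t x_{t+m}^\top-\frac{1}{T-m-2}\sum_{t=0}^{T-m-3}x_t x_{t+m+2}^\top,$$ and write $\|M\|_{\max}=\max_{i,j}|M_{ij}|$. (i) Let $m\ge0$, $0<\epsilon<\frac{4\sigma^2}{(1-\rho(A))^2}$ and $\delta>0$. If $$T\ge\max\left(\frac{64\,\sigma^4\bigl(1+2\sqrt{\log(2N^2/\delta)}\bigr)^2}{\epsilon^2(1-\rho(A))^4},\ 2(m+2)\right),$$ then with probability at least $1-\delta$ we have $\|\hat{\mathbb{S}}_m(T)-\sigma^2A^m\|_{\max}\le\epsilon$.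 (If $\delta>2N^2$, the square root is read as $0$; the claim is then trivial.) (ii) In particular, $T=O(\log N)$ observations suffice to recover $A$ and its powers elementwise: for all $m\ge 0$, $r<1$, $\epsilon>0$ and $\delta>0$ there is a constant $C$, depending only on $m,r,\epsilon,\delta$, such that for every $N\ge2$, every $\sigma>0$, every symmetric $A\in\mathbb{R}^{N\times N}$ (sparse or dense) with $\rho(A)\le r$, and every $T\ge C\log N$, with probability at least $1-\delta$ we have $\|\sigma^{-2}\hat{\mathbb{S}}_m(T)-A^m\|_{\max}\le\epsilon$. The case $m=1$ is the recovery of $A$ itself. -/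

import Mathlib

open MeasureTheory ProbabilityTheory

noncomputable section

/-- The spectral radius `ρ(A)` of a real square matrix: the largest modulus of a complex
eigenvalue of `A`. -/
def rho {N : ℕ} (A : Matrix (Fin N) (Fin N) ℝ) : ℝ :=
  (spectralRadius ℂ (A.map Complex.ofReal)).toReal

/-- The elementwise maximum norm `‖M‖_max = max_{i,j} |M i j|`. -/
def maxNorm {N : ℕ} (M : Matrix (Fin N) (Fin N) ℝ) : ℝ :=
  letI := Matrix.normedAddCommGroup (m := Fin N) (n := Fin N) (α := ℝ)
  ‖M‖

/-- The stochastic linear dynamics `x_t = A x_{t-1} + ξ_{t-1}` started at `x_0 = 0`, driven by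
i.i.d. Gaussian noise vectors `ξ_t ∼ N(0, σ² I)`. -/
structure IsLinearDynamics {N : ℕ} {Ω : Type*} [MeasurableSpace Ω] (P : Measure Ω)
    (A : Matrix (Fin N) (Fin N) ℝ) (σ : ℝ)
    (ξ x : ℕ → Ω → EuclideanSpace ℝ (Fin N)) : Prop where
  indep : iIndepFun ξ P
  law : ∀ t, HasLaw (ξ t)
    (multivariateGaussian 0 (σ ^ 2 • (1 : Matrix (Fin N) (Fin N) ℝ))) P
  init : ∀ ω, x 0 ω = 0
  step : ∀ t ω, x (t + 1) ω = Matrix.toEuclideanLin A (x t ω) + ξ t ω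

/-- The estimator
`Ŝ_m(T) = (T-m)⁻¹ ∑_{t=0}^{T-m-1} x_t x_{t+m}ᵀ - (T-m-2)⁻¹ ∑_{t=0}^{T-m-3} x_t x_{t+m+2}ᵀ`
computed from a trajectory `x`. It is only used for `T ≥ m + 3`. -/
def estimator {N : ℕ} (m T : ℕ) (x : ℕ → EuclideanSpace ℝ (Fin N)) :
    Matrix (Fin N) (Fin N) ℝ :=
  (1 / ((T : ℝ) - m)) •
      ∑ t ∈ Finset.range (T - m), Matrix.vecMulVec (x t) (x (t + m)) -
    (1 / ((T : ℝ) - m - 2)) •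
      ∑ t ∈ Finset.range (T - m - 2), Matrix.vecMulVec (x t) (x (t + m + 2))

end

/-! ### Concentration of Gaussian quadratic forms. -/

section GaussianChaos

open scoped RealInnerProductSpace

/-! For unit noise, the covariance of `x_t` and `x_{t+h}` is the sum of `A ^ (2k + h)` over `k < t`.
Passing from lag `m` to lag `m + 2` shifts `k` by one, so the difference of the two lags telescopes
to `A ^ m`, up to a bias of order `1 / T` (`abs_bias_le`).

For the fluctuations, stack the noise into one Gaussian vector `z`. Each entry of the estimator is
then a quadratic form `∑ t, ⟪a t, z⟫ * ⟪w t, z⟫`, and a Hanson–Wright bound applies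
(`measure_stdGaussian_abs_quadratic_ge_le`). Its constants follow from one energy estimate: the map
from noise to trajectory has norm at most `1 / (1 - ρ)` (`sum_norm_sq_trajectory_le`). This gives a
tail `2 exp (-r²)` per entry. A union bound over the `N²` entries forces `r² = log (2N² / δ)`, which
is the source of the `log N` sample size. -/

lemma inv_sqrt_one_sub_le_exp {x : ℝ} (hx : |x| ≤ 1 / 4) :
    (√(1 - 2 * x))⁻¹ ≤ Real.exp (x + 2 * x ^ 2) := by
  obtain ⟨h1, h2⟩ := abs_le.1 hx
  have h0 : 0 < 1 - 2 * x := by linarith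
  rw [← Real.sqrt_inv, Real.sqrt_le_left (Real.exp_pos _).le, ← Real.exp_nat_mul,
    inv_le_iff_one_le_mul₀ h0]
  push_cast
  -- The linear bound on `exp` would leave `(1 - 2x)(1 + 2x + 4x²) = 1 - 8x³`, which suffices only
  -- for `x ≤ 0`; positive `x` needs the quadratic term.
  rcases le_total 0 x with hx0 | hx0
  · have hw : 0 ≤ 2 * (x + 2 * x ^ 2) := by positivity
    have := Real.quadratic_le_exp_of_nonneg hw
    have h3 : 1 ≤ (1 - 2 * x) *
        (1 + 2 * (x + 2 * x ^ 2) + (2 * (x + 2 * x ^ 2)) ^ 2 / 2) := by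
      have : 0 ≤ x ^ 2 * (2 - 4 * x) := by
        apply mul_nonneg <;> nlinarith [sq_nonneg x]
      nlinarith [mul_nonneg (sq_nonneg x) (mul_nonneg hx0 hx0),
        mul_nonneg (sq_nonneg x) (mul_nonneg (mul_nonneg hx0 hx0) (sub_nonneg.2 h2))]
    rw [mul_comm] at h3
    exact h3.trans (mul_le_mul_of_nonneg_right this h0.le)
  · have := Real.add_one_le_exp (2 * (x + 2 * x ^ 2))
    have h3 : 1 ≤ (2 * (x + 2 * x ^ 2) + 1) * (1 - 2 * x) := by
      nlinarith [mul_nonneg (sq_nonneg x) (neg_nonneg.2 hx0)]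
    exact h3.trans (mul_le_mul_of_nonneg_right this h0.le)

lemma integrable_exp_mul_sq_gaussianReal {c : ℝ} (hc : c < 1 / 2) :
    Integrable (fun y : ℝ => Real.exp (c * y ^ 2)) (gaussianReal 0 1) := by
  rw [gaussianReal_of_var_ne_zero _ one_ne_zero, gaussianPDF_def,
    integrable_withDensity_iff_integrable_smul₀' (by fun_prop) (by simp)]
  have : Integrable (fun y : ℝ => (√(2 * Real.pi))⁻¹ * Real.exp (-(1 / 2 - c) * y ^ 2)) :=
    (integrable_exp_neg_mul_sq (by linarith)).const_mul _
  refine this.congr (ae_of_all _ fun y => ?_)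
  simp only [smul_eq_mul]
  rw [ENNReal.toReal_ofReal (gaussianPDFReal_nonneg _ _ _), gaussianPDFReal]
  simp only [NNReal.coe_one, mul_one, sub_zero]
  rw [mul_assoc, ← Real.exp_add]
  ring_nf

lemma integral_exp_mul_sq_gaussianReal {c : ℝ} (hc : c < 1 / 2) :
    ∫ y, Real.exp (c * y ^ 2) ∂(gaussianReal 0 1) = (√(1 - 2 * c))⁻¹ := by
  rw [integral_gaussianReal_eq_integral_smul one_ne_zero]
  have : ∀ y : ℝ, gaussianPDFReal 0 1 y • Real.exp (c * y ^ 2)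
      = (√(2 * Real.pi))⁻¹ * Real.exp (-(1 / 2 - c) * y ^ 2) := by
    intro y
    rw [gaussianPDFReal]
    simp only [NNReal.coe_one, mul_one, sub_zero, smul_eq_mul]
    rw [mul_assoc, ← Real.exp_add]
    ring_nf
  simp_rw [this]
  rw [integral_const_mul, integral_gaussian, ← Real.sqrt_inv, ← Real.sqrt_inv,
    ← Real.sqrt_mul (by positivity)]
  congr 1
  have : 1 - 2 * c ≠ 0 := by linarith
  have : 1 / 2 - c ≠ 0 := by linarith
  field_simp

/-- Chernoff bound for a diagonal Gaussian chaos of order two. -/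
lemma measure_pi_gaussianReal_diagonal_chaos_ge_le {ι : Type*} [Fintype ι] (d : ι → ℝ) {s : ℝ}
    (hs : 0 ≤ s) (hd : ∀ k, |s * d k| ≤ 1 / 4) (u : ℝ) :
    (Measure.pi fun _ : ι => gaussianReal 0 1).real
        {y | u ≤ ∑ k, d k * y k ^ 2 - ∑ k, d k} ≤
      Real.exp (-s * u + 2 * s ^ 2 * ∑ k, d k ^ 2) := by
  have hlt : ∀ k, s * d k < 1 / 2 := fun k => by
    linarith [le_abs_self (s * d k), hd k]
  have hexp : ∀ y : ι → ℝ, Real.exp (s * ∑ k, d k * y k ^ 2)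
      = ∏ k, Real.exp (s * d k * y k ^ 2) := by
    intro y
    rw [← Real.exp_sum, Finset.mul_sum]
    simp_rw [mul_assoc]
  have hint : Integrable (fun y : ι → ℝ => Real.exp (s * ∑ k, d k * y k ^ 2))
      (Measure.pi fun _ : ι => gaussianReal 0 1) := by
    simp_rw [hexp]
    exact Integrable.fintype_prod fun k => integrable_exp_mul_sq_gaussianReal (hlt k)
  have hset : {y : ι → ℝ | u ≤ ∑ k, d k * y k ^ 2 - ∑ k, d k}
      = {y | u + ∑ k, d k ≤ ∑ k, d k * y k ^ 2} := by
    ext y; simp [le_sub_iff_add_le]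
  rw [hset]
  refine (measure_ge_le_exp_mul_mgf (X := fun y : ι → ℝ => ∑ k, d k * y k ^ 2)
    (u + ∑ k, d k) hs hint).trans ?_
  have hmgf : mgf (fun y : ι → ℝ => ∑ k, d k * y k ^ 2)
      (Measure.pi fun _ : ι => gaussianReal 0 1) s ≤
        Real.exp (∑ k, (s * d k + 2 * (s * d k) ^ 2)) := by
    simp only [mgf]
    simp_rw [hexp]
    rw [integral_fintype_prod_eq_prod (f := fun k (z : ℝ) => Real.exp (s * d k * z ^ 2)),
      Real.exp_sum]
    refine Finset.prod_le_prod (fun k _ => integral_nonneg fun _ => (Real.exp_pos _).le)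
      fun k _ => ?_
    rw [integral_exp_mul_sq_gaussianReal (hlt k)]
    exact inv_sqrt_one_sub_le_exp (hd k)
  refine (mul_le_mul_of_nonneg_left hmgf (Real.exp_pos _).le).trans ?_
  rw [← Real.exp_add, Finset.sum_add_distrib, ← Finset.mul_sum, ← Finset.mul_sum]
  simp_rw [mul_pow]
  rw [← Finset.mul_sum]
  apply le_of_eq
  ring_nf

variable {E : Type*} [NormedAddCommGroup E] [InnerProductSpace ℝ E] [FiniteDimensional ℝ E]

/-- A quadratic form `∑ t, ⟪a t, x⟫ * ⟪w t, x⟫` is diagonal in some orthonormal basis. -/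
lemma exists_orthonormalBasis_diagonal_sum_inner_mul_inner {τ : Type*} [Fintype τ] (a w : τ → E) :
    ∃ b : OrthonormalBasis (Fin (Module.finrank ℝ E)) ℝ E, ∀ x,
      ∑ t, ⟪a t, x⟫ * ⟪w t, x⟫ =
        ∑ k, (∑ t, ⟪a t, b k⟫ * ⟪w t, b k⟫) * ⟪b k, x⟫ ^ 2 := by
  -- Symmetrising the form leaves its values unchanged and makes the spectral theorem available; the
  -- eigenvalue at `b k` is the form evaluated there.
  let S : E →ₗ[ℝ] E := (1 / 2 : ℝ) • ∑ t,
    ((innerSL ℝ (a t) : E →ₗ[ℝ] ℝ).smulRight (w t) +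
      (innerSL ℝ (w t) : E →ₗ[ℝ] ℝ).smulRight (a t))
  have hS : ∀ x, S x = (1 / 2 : ℝ) • ∑ t, (⟪a t, x⟫ • w t + ⟪w t, x⟫ • a t) := by
    intro x
    simp [S, LinearMap.sum_apply]
  have hSxy : ∀ x y, ⟪S x, y⟫ =
      (1 / 2 : ℝ) * ∑ t, (⟪a t, x⟫ * ⟪w t, y⟫ + ⟪w t, x⟫ * ⟪a t, y⟫) := by
    intro x y
    rw [hS, real_inner_smul_left, sum_inner]
    simp only [inner_add_left, real_inner_smul_left]
  have hsym : S.IsSymmetric := by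
    intro x y
    rw [← real_inner_comm x, hSxy, hSxy]
    congr 1
    exact Finset.sum_congr rfl fun t _ => by ring
  have hQ : ∀ x, ∑ t, ⟪a t, x⟫ * ⟪w t, x⟫ = ⟪S x, x⟫ := by
    intro x
    rw [hSxy, Finset.mul_sum]
    exact Finset.sum_congr rfl fun t _ => by ring
  refine ⟨hsym.eigenvectorBasis rfl, fun x => ?_⟩
  simp_rw [hQ]
  rw [← (hsym.eigenvectorBasis rfl).sum_inner_mul_inner (S x) x]
  refine Finset.sum_congr rfl fun k _ => ?_
  rw [hsym x, hsym.apply_eigenvectorBasis]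
  simp only [real_inner_smul_right, real_inner_smul_left, RCLike.ofReal_real_eq_id, id_eq]
  rw [real_inner_self_eq_norm_sq, OrthonormalBasis.norm_eq_one, real_inner_comm x]
  ring

variable [MeasurableSpace E] [BorelSpace E]

/-- In a diagonalising basis the Gaussian coordinates are independent standard normals, so only the
eigenvalues `d k` matter. Cauchy–Schwarz bounds each by `α * β` and the sum of their squares by `β ^
2 * F`; the centering term is the trace. -/
lemma measure_stdGaussian_quadratic_ge_le {τ : Type*} [Fintype τ] (a w : τ → E)
    {α β F s : ℝ} (hα : 0 ≤ α) (hβ : 0 ≤ β)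
    (ha : ∀ x, ∑ t, ⟪a t, x⟫ ^ 2 ≤ α ^ 2 * ‖x‖ ^ 2)
    (hw : ∀ x, ∑ t, ⟪w t, x⟫ ^ 2 ≤ β ^ 2 * ‖x‖ ^ 2)
    (hF : ∑ t, ‖a t‖ ^ 2 ≤ F) (hs : 0 ≤ s) (hsab : s * (α * β) ≤ 1 / 4) (u : ℝ) :
    (stdGaussian E).real
        {x | u ≤ ∑ t, ⟪a t, x⟫ * ⟪w t, x⟫ - ∑ t, ⟪a t, w t⟫} ≤
      Real.exp (-s * u + 2 * s ^ 2 * (β ^ 2 * F)) := by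
  obtain ⟨b, hb⟩ := exists_orthonormalBasis_diagonal_sum_inner_mul_inner a w
  set d : Fin (Module.finrank ℝ E) → ℝ := fun k => ∑ t, ⟪a t, b k⟫ * ⟪w t, b k⟫ with hd
  have hcs : ∀ k, d k ^ 2 ≤ (∑ t, ⟪a t, b k⟫ ^ 2) * ∑ t, ⟪w t, b k⟫ ^ 2 := fun k =>
    Finset.sum_mul_sq_le_sq_mul_sq _ _ _
  have hw1 : ∀ k, ∑ t, ⟪w t, b k⟫ ^ 2 ≤ β ^ 2 := fun k => by simpa using hw (b k)
  have ha1 : ∀ k, ∑ t, ⟪a t, b k⟫ ^ 2 ≤ α ^ 2 := fun k => by simpa using ha (b k)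
  have hdk : ∀ k, |d k| ≤ α * β := fun k => by
    apply abs_le_of_sq_le_sq _ (by positivity)
    rw [mul_pow]
    exact (hcs k).trans (mul_le_mul (ha1 k) (hw1 k) (by positivity) (by positivity))
  have hdsum : ∑ k, d k ^ 2 ≤ β ^ 2 * F := by
    calc ∑ k, d k ^ 2 ≤ ∑ k, (∑ t, ⟪a t, b k⟫ ^ 2) * β ^ 2 := by
          refine Finset.sum_le_sum fun k _ => (hcs k).trans ?_
          exact mul_le_mul_of_nonneg_left (hw1 k) (by positivity)
      _ = β ^ 2 * ∑ t, ‖a t‖ ^ 2 := by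
          rw [← Finset.sum_mul, Finset.sum_comm, mul_comm]
          simp_rw [b.sum_sq_inner_left]
      _ ≤ _ := mul_le_mul_of_nonneg_left hF (by positivity)
  have htr : ∑ t, ⟪a t, w t⟫ = ∑ k, d k := by
    rw [hd, Finset.sum_comm]
    refine Finset.sum_congr rfl fun t _ => ?_
    rw [← b.sum_inner_mul_inner (a t) (w t)]
    exact Finset.sum_congr rfl fun k _ => by rw [real_inner_comm (w t)]
  have hmeas : MeasurableSet {x : E | u ≤ ∑ t, ⟪a t, x⟫ * ⟪w t, x⟫ - ∑ t, ⟪a t, w t⟫} :=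
    measurableSet_le measurable_const (by fun_prop)
  rw [stdGaussian_eq_map_pi_orthonormalBasis b,
    map_measureReal_apply (by fun_prop) hmeas]
  have hset : (fun y : Fin (Module.finrank ℝ E) → ℝ => ∑ i, y i • b i) ⁻¹'
      {x : E | u ≤ ∑ t, ⟪a t, x⟫ * ⟪w t, x⟫ - ∑ t, ⟪a t, w t⟫} =
      {y | u ≤ ∑ k, d k * y k ^ 2 - ∑ k, d k} := by
    ext y
    have : ∀ k, ⟪b k, ∑ i, y i • b i⟫ = y k := fun k => by
      rw [b.orthonormal.inner_right_fintype]
    rw [Set.mem_preimage, Set.mem_ofPred_eq, Set.mem_ofPred_eq, hb, htr]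
    simp only [this, d]
  rw [hset]
  refine (measure_pi_gaussianReal_diagonal_chaos_ge_le d hs (fun k => ?_) u).trans ?_
  · rw [abs_mul, abs_of_nonneg hs]
    exact (mul_le_mul_of_nonneg_left (hdk k) hs).trans hsab
  · gcongr

/-- A Hanson–Wright inequality for quadratic forms of a standard Gaussian vector. -/
lemma measure_stdGaussian_abs_quadratic_ge_le {τ : Type*} [Fintype τ] (a w : τ → E)
    {α β F s : ℝ} (hα : 0 ≤ α) (hβ : 0 ≤ β)
    (ha : ∀ x, ∑ t, ⟪a t, x⟫ ^ 2 ≤ α ^ 2 * ‖x‖ ^ 2)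
    (hw : ∀ x, ∑ t, ⟪w t, x⟫ ^ 2 ≤ β ^ 2 * ‖x‖ ^ 2)
    (hF : ∑ t, ‖a t‖ ^ 2 ≤ F) (hs : 0 ≤ s) (hsab : s * (α * β) ≤ 1 / 4) (u : ℝ) :
    (stdGaussian E).real
        {x | u ≤ |∑ t, ⟪a t, x⟫ * ⟪w t, x⟫ - ∑ t, ⟪a t, w t⟫|} ≤
      2 * Real.exp (-s * u + 2 * s ^ 2 * (β ^ 2 * F)) := by
  have h1 := measure_stdGaussian_quadratic_ge_le a w hα hβ ha hw hF hs hsab u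
  have h2 := measure_stdGaussian_quadratic_ge_le a (fun t => -w t) hα hβ ha
    (by simpa only [inner_neg_left, neg_sq] using hw) hF hs hsab u
  have hset : {x : E | u ≤ |∑ t, ⟪a t, x⟫ * ⟪w t, x⟫ - ∑ t, ⟪a t, w t⟫|} ⊆
      {x | u ≤ ∑ t, ⟪a t, x⟫ * ⟪w t, x⟫ - ∑ t, ⟪a t, w t⟫} ∪
      {x | u ≤ ∑ t, ⟪a t, x⟫ * ⟪-w t, x⟫ - ∑ t, ⟪a t, -w t⟫} := by
    intro x hx
    rcases le_abs.1 (Set.mem_ofPred_eq ▸ hx) with h | h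
    · exact Or.inl h
    · right
      simp only [Set.mem_ofPred_eq, inner_neg_left, inner_neg_right, mul_neg,
        Finset.sum_neg_distrib]
      linarith
  refine (measureReal_mono hset).trans ((measureReal_union_le _ _).trans ?_)
  linarith

end GaussianChaos

/-! ### The noise-to-trajectory map, its norm, and the covariances. -/

section Trajectory

open scoped RealInnerProductSpace

variable {N : ℕ} {A : Matrix (Fin N) (Fin N) ℝ}

open Matrix.Norms.L2Operator in
-- Symmetry makes the complexified matrix self-adjoint, so that its spectral radius is its operator
-- norm.
lemma rho_eq_norm_map_ofReal (hA : A.IsSymm) : rho A = ‖A.map Complex.ofReal‖ := by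
  have : IsSelfAdjoint (A.map Complex.ofReal) := by
    rw [isSelfAdjoint_iff, Matrix.star_eq_conjTranspose]
    ext i j
    simp [Matrix.conjTranspose_apply, hA.apply]
  rw [rho, this.spectralRadius_eq_nnnorm]
  simp

lemma rho_nonneg (A : Matrix (Fin N) (Fin N) ℝ) : 0 ≤ rho A := ENNReal.toReal_nonneg

open Matrix.Norms.L2Operator in
lemma norm_toEuclideanLin_le (hA : A.IsSymm) (v : EuclideanSpace ℝ (Fin N)) :
    ‖Matrix.toEuclideanLin A v‖ ≤ rho A * ‖v‖ := by
  have h := Matrix.l2_opNorm_mulVec (A.map Complex.ofReal)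
    (WithLp.toLp 2 fun i => (v i : ℂ))
  rw [← rho_eq_norm_map_ofReal hA] at h
  have h1 : ‖(WithLp.toLp 2 fun i => (v i : ℂ) : EuclideanSpace ℂ (Fin N))‖ = ‖v‖ := by
    simp [EuclideanSpace.norm_eq]
  have h2 : ‖(EuclideanSpace.equiv (Fin N) ℂ).symm ((A.map Complex.ofReal).mulVec
      (WithLp.toLp 2 fun i => (v i : ℂ) : EuclideanSpace ℂ (Fin N)).ofLp)‖ =
      ‖Matrix.toEuclideanLin A v‖ := by
    rw [EuclideanSpace.norm_eq, EuclideanSpace.norm_eq]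
    congr 1
    refine Finset.sum_congr rfl fun i _ => ?_
    congr 1
    rw [Matrix.toLpLin_apply]
    simp only [Matrix.mulVec, dotProduct, Matrix.map_apply, PiLp.continuousLinearEquiv_symm_apply]
    simp_rw [← Complex.ofReal_mul]
    rw [← Complex.ofReal_sum, Complex.norm_real]
  rwa [h1, h2] at h

lemma norm_toEuclideanLin_pow_le (hA : A.IsSymm) (k : ℕ) (v : EuclideanSpace ℝ (Fin N)) :
    ‖Matrix.toEuclideanLin (A ^ k) v‖ ≤ rho A ^ k * ‖v‖ := by
  induction k with
  | zero => simp
  | succ k ih =>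
    have : Matrix.toEuclideanLin (A ^ (k + 1)) v =
        Matrix.toEuclideanLin A (Matrix.toEuclideanLin (A ^ k) v) := by
      simp [Matrix.toLpLin_apply, pow_succ']
    rw [this, pow_succ', mul_assoc]
    exact (norm_toEuclideanLin_le hA _).trans (mul_le_mul_of_nonneg_left ih (rho_nonneg A))

lemma abs_pow_apply_le (hA : A.IsSymm) (k : ℕ) (i j : Fin N) :
    |(A ^ k) i j| ≤ rho A ^ k := by
  have h1 := norm_toEuclideanLin_pow_le hA k (EuclideanSpace.single j (1 : ℝ))
  have h2 := PiLp.norm_apply_le (Matrix.toEuclideanLin (A ^ k) (EuclideanSpace.single j (1 : ℝ))) i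
  have h3 : (Matrix.toEuclideanLin (A ^ k) (EuclideanSpace.single j (1 : ℝ))) i = (A ^ k) i j := by
    rw [Matrix.toLpLin_apply]
    simp
  rw [h3, Real.norm_eq_abs] at h2
  simpa using h2.trans h1

/-- The trajectory of `x_{t+1} = A x_t + z_t` started at `0`. -/
noncomputable def trajectory (A : Matrix (Fin N) (Fin N) ℝ)
    (z : ℕ → EuclideanSpace ℝ (Fin N)) : ℕ → EuclideanSpace ℝ (Fin N)
  | 0 => 0
  | t + 1 => Matrix.toEuclideanLin A (trajectory A z t) + z t

lemma trajectory_congr {z z' : ℕ → EuclideanSpace ℝ (Fin N)} {t : ℕ}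
    (h : ∀ s < t, z s = z' s) : trajectory A z t = trajectory A z' t := by
  induction t with
  | zero => rfl
  | succ t ih =>
    rw [trajectory, trajectory, ih fun s hs => h s (by omega), h t (by omega)]

lemma trajectory_apply (z : ℕ → EuclideanSpace ℝ (Fin N)) (t : ℕ) (i : Fin N) :
    trajectory A z t i = ∑ s ∈ Finset.range t, ∑ l, (A ^ (t - 1 - s)) i l * z s l := by
  induction t generalizing i with
  | zero => simp [trajectory]
  | succ t ih =>
    rw [trajectory, Finset.sum_range_succ]
    have h0 : ∑ l, (A ^ (t + 1 - 1 - t)) i l * z t l = z t i := by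
      simp [Matrix.one_apply]
    rw [h0, PiLp.add_apply, Matrix.toLpLin_apply]
    congr 1
    simp only [Matrix.mulVec, dotProduct]
    simp_rw [ih, Finset.mul_sum]
    rw [Finset.sum_comm]
    refine Finset.sum_congr rfl fun s hs => ?_
    have hs' := Finset.mem_range.1 hs
    rw [show t + 1 - 1 - s = t - 1 - s + 1 by omega, pow_succ']
    rw [Finset.sum_comm]
    refine Finset.sum_congr rfl fun l _ => ?_
    rw [Matrix.mul_apply, Finset.sum_mul]
    exact Finset.sum_congr rfl fun k _ => by ring

/-- Convexity gives `(ρ a + b)² ≤ ρ a² + b² / (1 - ρ)`. Summing over time and absorbing the `ρ` term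
on the left yields the constant, uniformly in the horizon. -/
lemma sum_norm_sq_trajectory_le (hA : A.IsSymm) (hρ : rho A < 1)
    (z : ℕ → EuclideanSpace ℝ (Fin N)) (n : ℕ) :
    ∑ t ∈ Finset.range (n + 1), ‖trajectory A z t‖ ^ 2 ≤
      (1 / (1 - rho A)) ^ 2 * ∑ t ∈ Finset.range n, ‖z t‖ ^ 2 := by
  have hD : 0 < 1 - rho A := by linarith
  have hstep : ∀ t, (1 - rho A) * ‖trajectory A z (t + 1)‖ ^ 2 ≤
      (1 - rho A) * (rho A * ‖trajectory A z t‖ ^ 2) + ‖z t‖ ^ 2 := by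
    intro t
    have h1 : ‖trajectory A z (t + 1)‖ ≤ rho A * ‖trajectory A z t‖ + ‖z t‖ :=
      (norm_add_le _ _).trans (add_le_add_left (norm_toEuclideanLin_le hA _) _)
    have h2 := pow_le_pow_left₀ (norm_nonneg _) h1 2
    have h3 := mul_le_mul_of_nonneg_left h2 hD.le
    nlinarith [mul_nonneg (rho_nonneg A)
      (sq_nonneg ((1 - rho A) * ‖trajectory A z t‖ - ‖z t‖))]
  have h0 : ‖trajectory A z 0‖ ^ 2 = 0 := by simp [trajectory]
  have hsum : (1 - rho A) * ∑ t ∈ Finset.range (n + 1), ‖trajectory A z t‖ ^ 2 ≤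
      (1 - rho A) * (rho A * ∑ t ∈ Finset.range (n + 1), ‖trajectory A z t‖ ^ 2) +
        ∑ t ∈ Finset.range n, ‖z t‖ ^ 2 := by
    calc _ = ∑ t ∈ Finset.range n, (1 - rho A) * ‖trajectory A z (t + 1)‖ ^ 2 := by
          rw [Finset.sum_range_succ', h0, add_zero, Finset.mul_sum]
      _ ≤ ∑ t ∈ Finset.range n,
          ((1 - rho A) * (rho A * ‖trajectory A z t‖ ^ 2) + ‖z t‖ ^ 2) :=
          Finset.sum_le_sum fun t _ => hstep t
      _ ≤ _ := by
          rw [Finset.sum_add_distrib, ← Finset.mul_sum, ← Finset.mul_sum,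
            Finset.sum_range_succ (fun t => ‖trajectory A z t‖ ^ 2)]
          have := rho_nonneg A
          gcongr
          nlinarith [sq_nonneg ‖trajectory A z n‖]
  rw [div_pow, one_pow, one_div, inv_mul_eq_div, le_div_iff₀ (by positivity)]
  nlinarith

/-- Extension by zero of a finite noise sequence. -/
noncomputable def extendNoise {L : ℕ} (z : PiLp 2 fun _ : Fin L => EuclideanSpace ℝ (Fin N))
    (s : ℕ) : EuclideanSpace ℝ (Fin N) :=
  if h : s < L then z ⟨s, h⟩ else 0

lemma sum_norm_sq_extendNoise {L : ℕ} (z : PiLp 2 fun _ : Fin L => EuclideanSpace ℝ (Fin N)) :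
    ∑ s ∈ Finset.range L, ‖extendNoise z s‖ ^ 2 = ‖z‖ ^ 2 := by
  rw [PiLp.norm_sq_eq_of_L2, Finset.sum_range]
  simp [extendNoise]

lemma sum_norm_sq_trajectory_extendNoise_le (hA : A.IsSymm) (hρ : rho A < 1) {L n : ℕ}
    (hn : n ≤ L + 1) (z : PiLp 2 fun _ : Fin L => EuclideanSpace ℝ (Fin N)) :
    ∑ t ∈ Finset.range n, ‖trajectory A (extendNoise z) t‖ ^ 2 ≤
      (1 / (1 - rho A)) ^ 2 * ‖z‖ ^ 2 := by
  rw [← sum_norm_sq_extendNoise]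
  refine le_trans ?_ (sum_norm_sq_trajectory_le hA hρ _ L)
  exact Finset.sum_le_sum_of_subset_of_nonneg (Finset.range_mono hn) fun _ _ _ => by positivity

/-- The vector representing the functional `z ↦ x_t(i)`. -/
noncomputable def responseVec (A : Matrix (Fin N) (Fin N) ℝ) (L t : ℕ) (i : Fin N) :
    PiLp 2 fun _ : Fin L => EuclideanSpace ℝ (Fin N) :=
  WithLp.toLp 2 fun s =>
    if (s : ℕ) < t then WithLp.toLp 2 fun l => (A ^ (t - 1 - s)) i l else 0

lemma inner_responseVec {L t : ℕ} (ht : t ≤ L) (i : Fin N)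
    (z : PiLp 2 fun _ : Fin L => EuclideanSpace ℝ (Fin N)) :
    ⟪responseVec A L t i, z⟫ = trajectory A (extendNoise z) t i := by
  rw [trajectory_apply, PiLp.inner_apply]
  have h1 : ∀ s : Fin L, ⟪responseVec A L t i s, z s⟫ =
      if (s : ℕ) < t then ∑ l, (A ^ (t - 1 - (s : ℕ))) i l * extendNoise z s l else 0 := by
    intro s
    simp only [responseVec, extendNoise, s.2, dite_true]
    split_ifs
    · simp [PiLp.inner_apply, mul_comm]
    · simp
  simp_rw [h1]
  rw [← Finset.sum_range (fun s : ℕ =>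
    if s < t then ∑ l, (A ^ (t - 1 - s)) i l * extendNoise z s l else 0), ← Finset.sum_filter]
  congr 1
  ext s
  simp
  omega

/-- Drive the system by the response vector `v` itself: `‖v‖ ^ 2` is then a coordinate of the
trajectory, which the energy estimate bounds by `‖v‖ / (1 - ρ)`. -/
lemma norm_responseVec_le (hA : A.IsSymm) (hρ : rho A < 1) {L t : ℕ} (ht : t ≤ L) (i : Fin N) :
    ‖responseVec A L t i‖ ≤ 1 / (1 - rho A) := by
  have hD : 0 < 1 - rho A := by linarith
  set v := responseVec A L t i with hv
  have h1 : ‖v‖ ^ 2 ≤ ‖trajectory A (extendNoise v) t‖ := by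
    rw [← real_inner_self_eq_norm_sq]
    nth_rw 1 [hv]
    rw [inner_responseVec ht]
    have := PiLp.norm_apply_le (trajectory A (extendNoise v) t) i
    rw [Real.norm_eq_abs] at this
    exact (le_abs_self _).trans this
  have h2 : ‖trajectory A (extendNoise v) t‖ ^ 2 ≤ (1 / (1 - rho A) * ‖v‖) ^ 2 := by
    rw [mul_pow]
    refine le_trans ?_ (sum_norm_sq_trajectory_extendNoise_le hA hρ le_rfl v)
    exact Finset.single_le_sum (f := fun t => ‖trajectory A (extendNoise v) t‖ ^ 2)
      (fun _ _ => by positivity) (Finset.mem_range.2 (by omega))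
  have h3 := h1.trans (le_of_sq_le_sq h2 (by positivity))
  rcases (norm_nonneg v).eq_or_lt with h | h
  · rw [← h]; positivity
  · exact le_of_mul_le_mul_right (by rwa [sq] at h3) h

/-- For unit noise this inner product is the covariance of `x_t(i)` and `x_{t+h}(j)`. Symmetry of
`A` lets the two powers multiply into one. -/
lemma inner_responseVec_responseVec (hA : A.IsSymm) {L t h : ℕ} (ht : t + h ≤ L) (i j : Fin N) :
    ⟪responseVec A L t i, responseVec A L (t + h) j⟫ =
      ∑ k ∈ Finset.range t, (A ^ (2 * k + h)) i j := by
  rw [inner_responseVec (by omega), trajectory_apply,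
    ← Finset.sum_range_reflect (fun k => (A ^ (2 * k + h)) i j)]
  refine Finset.sum_congr rfl fun s hs => ?_
  have hs' := Finset.mem_range.1 hs
  have h1 : ∀ l, extendNoise (responseVec A L (t + h) j) s l = (A ^ (t - 1 - s + h)) l j := by
    intro l
    rw [← (hA.pow (t - 1 - s + h)).apply l j]
    simp only [extendNoise, responseVec, show s < L by omega, dite_true, show s < t + h by omega,
      if_true]
    rw [show t + h - 1 - s = t - 1 - s + h by omega]
  simp_rw [h1]
  rw [← Matrix.mul_apply, ← pow_add, ← add_assoc, ← two_mul]

lemma abs_sum_pow_apply_le (hA : A.IsSymm) (hρ : rho A < 1) (h t : ℕ) (i j : Fin N) :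
    |∑ k ∈ Finset.range t, (A ^ (2 * k + h)) i j| ≤ 1 / (1 - rho A) := by
  have h0 := rho_nonneg A
  calc _ ≤ ∑ k ∈ Finset.range t, |(A ^ (2 * k + h)) i j| := Finset.abs_sum_le_sum_abs _ _
    _ ≤ ∑ k ∈ Finset.range t, rho A ^ k := by
        refine Finset.sum_le_sum fun k _ => (abs_pow_apply_le hA _ i j).trans ?_
        exact pow_le_pow_of_le_one h0 hρ.le (by omega)
    _ ≤ ∑' k, rho A ^ k :=
        (summable_geometric_of_lt_one h0 hρ).sum_le_tsum _ fun _ _ => by positivity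
    _ = 1 / (1 - rho A) := by rw [tsum_geometric_of_lt_one h0 hρ, one_div]

/-- The bias of the estimator with `n + 2` and `n` summands. -/
lemma abs_bias_le (hA : A.IsSymm) (hρ : rho A < 1) (m n : ℕ) (hn : 0 < n) (i j : Fin N) :
    |(1 / ((n : ℝ) + 2)) * ∑ t ∈ Finset.range (n + 2),
          ∑ k ∈ Finset.range t, (A ^ (2 * k + m)) i j -
        (1 / (n : ℝ)) * ∑ t ∈ Finset.range n,
          ∑ k ∈ Finset.range t, (A ^ (2 * k + (m + 2))) i j - (A ^ m) i j| ≤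
      4 / (n + 2) * (1 / (1 - rho A)) := by
  have hD : 0 < 1 - rho A := by linarith
  have h0 := rho_nonneg A
  have hn' : (0 : ℝ) < n := by exact_mod_cast hn
  set c : ℕ → ℝ := fun t => ∑ k ∈ Finset.range t, (A ^ (2 * k + (m + 2))) i j with hc
  -- The telescoping: splitting off `k = 0` turns the lag `m` covariance at time `t + 1` into `A ^
  -- m` plus the lag `m + 2` covariance at time `t`.
  have hrec : ∀ t, ∑ k ∈ Finset.range (t + 1), (A ^ (2 * k + m)) i j = (A ^ m) i j + c t := by
    intro t
    rw [Finset.sum_range_succ', add_comm, mul_zero, zero_add]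
    congr 1
    refine Finset.sum_congr rfl fun k _ => ?_
    rw [show 2 * (k + 1) + m = 2 * k + (m + 2) by ring]
  have hc1 : ∀ t, |c t| ≤ 1 / (1 - rho A) := fun t => abs_sum_pow_apply_le hA hρ _ _ _ _
  -- The `t = 0` term vanishes because `x_0 = 0`, so `A ^ m` occurs `n + 1` times, not `n + 2`.
  have hfirst : ∑ t ∈ Finset.range (n + 2), ∑ k ∈ Finset.range t, (A ^ (2 * k + m)) i j =
      (n + 1) * (A ^ m) i j + (∑ t ∈ Finset.range n, c t + c n) := by
    rw [Finset.sum_range_succ', Finset.sum_range_zero, add_zero, ← Finset.sum_range_succ]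
    simp_rw [hrec]
    rw [Finset.sum_add_distrib, Finset.sum_const, Finset.card_range, nsmul_eq_mul]
    push_cast
    ring
  rw [hfirst]
  have hid : (1 / ((n : ℝ) + 2)) * ((n + 1) * (A ^ m) i j + (∑ t ∈ Finset.range n, c t + c n)) -
        (1 / (n : ℝ)) * ∑ t ∈ Finset.range n, c t - (A ^ m) i j =
      (1 / ((n : ℝ) + 2)) *
        (c n - (A ^ m) i j - 2 * ((1 / (n : ℝ)) * ∑ t ∈ Finset.range n, c t)) := by
    field_simp
    ring
  have hS : |(1 / (n : ℝ)) * ∑ t ∈ Finset.range n, c t| ≤ 1 / (1 - rho A) := by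
    rw [abs_mul, abs_of_pos (by positivity), one_div_mul_eq_div, div_le_iff₀ hn']
    refine (Finset.abs_sum_le_sum_abs _ _).trans ((Finset.sum_le_sum fun t _ => hc1 t).trans ?_)
    rw [Finset.sum_const, Finset.card_range, nsmul_eq_mul, mul_comm]
  have hm : |(A ^ m) i j| ≤ 1 / (1 - rho A) := by
    refine (abs_pow_apply_le hA m i j).trans ((pow_le_one₀ h0 hρ.le).trans ?_)
    rw [le_div_iff₀ hD]; linarith
  rw [hid, abs_mul, abs_of_pos (by positivity),
    show 4 / ((n : ℝ) + 2) * (1 / (1 - rho A)) = 1 / ((n : ℝ) + 2) * (4 * (1 / (1 - rho A))) by ring]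
  refine mul_le_mul_of_nonneg_left ?_ (by positivity)
  have := abs_sub (c n - (A ^ m) i j) (2 * ((1 / (n : ℝ)) * ∑ t ∈ Finset.range n, c t))
  have := abs_sub (c n) ((A ^ m) i j)
  have h2 : |2 * ((1 / (n : ℝ)) * ∑ t ∈ Finset.range n, c t)| =
      2 * |(1 / (n : ℝ)) * ∑ t ∈ Finset.range n, c t| := by
    rw [abs_mul, abs_two]
  linarith [hc1 n]

end Trajectory

/-! ### The estimator as a quadratic form in the noise, and its deviation. -/

section Estimator

open scoped RealInnerProductSpace

variable {N : ℕ} {A : Matrix (Fin N) (Fin N) ℝ}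

lemma estimator_apply (m n : ℕ) (x : ℕ → EuclideanSpace ℝ (Fin N)) (i j : Fin N) :
    estimator m (n + m + 2) x i j =
      1 / ((n : ℝ) + 2) * ∑ t ∈ Finset.range (n + 2), x t i * x (t + m) j -
        1 / (n : ℝ) * ∑ t ∈ Finset.range n, x t i * x (t + (m + 2)) j := by
  have h1 : (((n + m + 2 : ℕ) : ℝ) - m) = n + 2 := by push_cast; ring
  have h2 : (((n + m + 2 : ℕ) : ℝ) - m - 2) = n := by push_cast; ring
  have h3 : n + m + 2 - m = n + 2 := by omega
  have h4 : n + m + 2 - m - 2 = n := by omega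
  rw [estimator, h2, h1, h4, h3]
  simp [Matrix.sum_apply, Matrix.vecMulVec_apply, add_assoc]

/-- The vectors `w_t` for which entry `(i, j)` of the estimator is `∑ t, ⟪a_t, z⟫ * ⟪w_t, z⟫`,
where `a_t` represents `x_t(i)`. -/
noncomputable def lagVec (A : Matrix (Fin N) (Fin N) ℝ) (m n : ℕ) (j : Fin N) (t : ℕ) :
    PiLp 2 fun _ : Fin (n + m + 2) => EuclideanSpace ℝ (Fin N) :=
  (1 / ((n : ℝ) + 2)) • responseVec A (n + m + 2) (t + m) j -
    if t < n then (1 / (n : ℝ)) • responseVec A (n + m + 2) (t + (m + 2)) j else 0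

/-- Stated for arbitrary functionals because it serves twice: with `⟪a t, z⟫ • ⟪z, ·⟫` for the
estimator and with `⟪a t, ·⟫` for its mean. -/
lemma sum_linearMap_lagVec (m n : ℕ) (j : Fin N)
    (φ : ℕ → (PiLp 2 fun _ : Fin (n + m + 2) => EuclideanSpace ℝ (Fin N)) →ₗ[ℝ] ℝ) :
    ∑ t : Fin (n + 2), φ t (lagVec A m n j t) =
      1 / ((n : ℝ) + 2) * ∑ t ∈ Finset.range (n + 2), φ t (responseVec A (n + m + 2) (t + m) j) -
        1 / (n : ℝ) * ∑ t ∈ Finset.range n, φ t (responseVec A (n + m + 2) (t + (m + 2)) j) := by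
  rw [← Finset.sum_range (fun t => φ t (lagVec A m n j t))]
  simp only [lagVec, map_sub, map_smul, smul_eq_mul]
  rw [Finset.sum_sub_distrib, ← Finset.mul_sum]
  congr 1
  have h : ∀ t, φ t (if t < n then (1 / (n : ℝ)) • responseVec A (n + m + 2) (t + (m + 2)) j else 0) =
      if t < n then 1 / (n : ℝ) * φ t (responseVec A (n + m + 2) (t + (m + 2)) j) else 0 := by
    intro t
    split_ifs <;> simp
  simp_rw [h]
  rw [← Finset.sum_filter, Finset.mul_sum]
  congr 1
  ext t
  simp
  omega

lemma estimator_trajectory_apply (m n : ℕ) (i j : Fin N)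
    (z : PiLp 2 fun _ : Fin (n + m + 2) => EuclideanSpace ℝ (Fin N)) :
    estimator m (n + m + 2) (trajectory A (extendNoise z)) i j =
      ∑ t : Fin (n + 2), ⟪responseVec A (n + m + 2) t i, z⟫ * ⟪lagVec A m n j t, z⟫ := by
  have h := sum_linearMap_lagVec (A := A) m n j
    fun t => ⟪responseVec A (n + m + 2) t i, z⟫ • (innerSL ℝ z).toLinearMap
  simp only [LinearMap.smul_apply, ContinuousLinearMap.coe_coe, innerSL_apply_apply,
    smul_eq_mul, real_inner_comm _ z] at h
  rw [h, estimator_apply]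
  congr 2 <;> refine Finset.sum_congr rfl fun t ht => ?_ <;>
    have ht' := Finset.mem_range.1 ht <;>
    rw [inner_responseVec (by omega), inner_responseVec (by omega)]

lemma sum_inner_responseVec_lagVec (hA : A.IsSymm) (m n : ℕ) (i j : Fin N) :
    ∑ t : Fin (n + 2), ⟪responseVec A (n + m + 2) t i, lagVec A m n j t⟫ =
      (1 / ((n : ℝ) + 2)) * ∑ t ∈ Finset.range (n + 2),
          ∑ k ∈ Finset.range t, (A ^ (2 * k + m)) i j -
        (1 / (n : ℝ)) * ∑ t ∈ Finset.range n,
          ∑ k ∈ Finset.range t, (A ^ (2 * k + (m + 2))) i j := by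
  have h := sum_linearMap_lagVec (A := A) m n j
    fun t => (innerSL ℝ (responseVec A (n + m + 2) t i)).toLinearMap
  simp only [ContinuousLinearMap.coe_coe, innerSL_apply_apply] at h
  rw [h]
  congr 2 <;> refine Finset.sum_congr rfl fun t ht => ?_ <;>
    have ht' := Finset.mem_range.1 ht
  · exact inner_responseVec_responseVec hA (by omega) i j
  · exact inner_responseVec_responseVec hA (by omega) i j

lemma sum_sq_inner_responseVec_le (hA : A.IsSymm) (hρ : rho A < 1) (L n : ℕ)
    (h : ℕ) (hh : h + n ≤ L + 1) (i : Fin N)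
    (z : PiLp 2 fun _ : Fin L => EuclideanSpace ℝ (Fin N)) :
    ∑ t ∈ Finset.range n, ⟪responseVec A L (t + h) i, z⟫ ^ 2 ≤
      (1 / (1 - rho A)) ^ 2 * ‖z‖ ^ 2 := by
  refine le_trans ?_ (sum_norm_sq_trajectory_extendNoise_le hA hρ hh z)
  rw [Finset.sum_range_add]
  refine le_trans (Finset.sum_le_sum fun t ht => ?_)
    (le_add_of_nonneg_left (Finset.sum_nonneg fun _ _ => by positivity))
  have ht' := Finset.mem_range.1 ht
  rw [inner_responseVec (by omega), add_comm t h]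
  have := PiLp.norm_apply_le (trajectory A (extendNoise z) (h + t)) i
  rw [Real.norm_eq_abs] at this
  exact sq_le_sq' (by linarith [neg_abs_le (trajectory A (extendNoise z) (h + t) i)])
    ((le_abs_self _).trans this)

/-- By `(p - q)² ≤ 2p² + 2q²`, each lag contributes at most `2 / n²` times the squared norm of the
trajectory map. -/
lemma sum_sq_inner_lagVec_le (hA : A.IsSymm) (hρ : rho A < 1) (m n : ℕ) (hn : 0 < n) (j : Fin N)
    (z : PiLp 2 fun _ : Fin (n + m + 2) => EuclideanSpace ℝ (Fin N)) :
    ∑ t : Fin (n + 2), ⟪lagVec A m n j t, z⟫ ^ 2 ≤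
      (2 / n * (1 / (1 - rho A))) ^ 2 * ‖z‖ ^ 2 := by
  have hn' : (0 : ℝ) < n := by exact_mod_cast hn
  rw [← Finset.sum_range (fun t => ⟪lagVec A m n j t, z⟫ ^ 2)]
  have h1 := sum_sq_inner_responseVec_le hA hρ (n + m + 2) (n + 2) m (by omega) j z
  have h2 := sum_sq_inner_responseVec_le hA hρ (n + m + 2) n (m + 2) (by omega) j z
  have hle : 1 / ((n : ℝ) + 2) ≤ 1 / n := one_div_le_one_div_of_le hn' (by linarith)
  have hle2 : (1 / ((n : ℝ) + 2)) ^ 2 ≤ (1 / n) ^ 2 := pow_le_pow_left₀ (by positivity) hle 2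
  have hterm : ∀ t, ⟪lagVec A m n j t, z⟫ ^ 2 ≤
      2 * (1 / (n : ℝ)) ^ 2 * ⟪responseVec A (n + m + 2) (t + m) j, z⟫ ^ 2 +
      if t < n then 2 * (1 / (n : ℝ)) ^ 2 *
        ⟪responseVec A (n + m + 2) (t + (m + 2)) j, z⟫ ^ 2 else 0 := by
    intro t
    set p := ⟪responseVec A (n + m + 2) (t + m) j, z⟫ with hp
    have hp2 := mul_le_mul_of_nonneg_right hle2 (sq_nonneg p)
    split_ifs with ht
    · rw [lagVec, if_pos ht, inner_sub_left, real_inner_smul_left, real_inner_smul_left,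
        ← hp]
      set q := ⟪responseVec A (n + m + 2) (t + (m + 2)) j, z⟫
      nlinarith [sq_nonneg (1 / ((n : ℝ) + 2) * p + 1 / (n : ℝ) * q)]
    · rw [lagVec, if_neg ht, sub_zero, real_inner_smul_left, ← hp]
      nlinarith [mul_nonneg (sq_nonneg (1 / (n : ℝ))) (sq_nonneg p)]
  refine (Finset.sum_le_sum fun t _ => hterm t).trans ?_
  rw [Finset.sum_add_distrib, ← Finset.mul_sum, ← Finset.sum_filter,
    show (Finset.range (n + 2)).filter (· < n) = Finset.range n by ext; simp; omega,
    ← Finset.mul_sum]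
  have hc : 0 ≤ 2 * (1 / (n : ℝ)) ^ 2 := by positivity
  refine (add_le_add (mul_le_mul_of_nonneg_left h1 hc) (mul_le_mul_of_nonneg_left h2 hc)).trans
    (le_of_eq ?_)
  ring

/-- The threshold splits into `16 r / (D² √T)` for the fluctuation and `8 / (D² √T)` for the bias,
where `D = 1 - ρ` and `T = n + m + 2`. -/
lemma measure_stdGaussian_estimator_deviation_le (hA : A.IsSymm) (hρ : rho A < 1) (m n : ℕ)
    (hmn : m + 2 ≤ n) (i j : Fin N) {r : ℝ} (hr : 0 ≤ r) (hrn : 2 * r ≤ √((n + m + 2 : ℕ) : ℝ)) :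
    (stdGaussian (PiLp 2 fun _ : Fin (n + m + 2) => EuclideanSpace ℝ (Fin N))).real
      {z | 8 * (1 + 2 * r) / ((1 - rho A) ^ 2 * √((n + m + 2 : ℕ) : ℝ)) <
        |estimator m (n + m + 2) (trajectory A (extendNoise z)) i j - (A ^ m) i j|} ≤
      2 * Real.exp (-r ^ 2) := by
  have hD : 0 < 1 - rho A := by linarith
  have h0 := rho_nonneg A
  set D := 1 - rho A with hDdef
  have hD1 : D ≤ 1 := by linarith
  set τ : ℝ := ((n + m + 2 : ℕ) : ℝ) with hτ
  have hτ1 : 1 ≤ τ := by rw [hτ]; exact_mod_cast (by omega)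
  have hτn : τ ≤ 2 * n := by rw [hτ]; exact_mod_cast (by omega)
  have hnτ : (n : ℝ) + 2 ≤ τ := by rw [hτ]; exact_mod_cast (by omega)
  have hn : (0 : ℝ) < n := by linarith
  set y := √τ with hy
  have hy1 : 1 ≤ y := Real.one_le_sqrt.2 hτ1
  have hy2 : y ^ 2 = τ := Real.sq_sqrt (by linarith)
  set a : Fin (n + 2) → PiLp 2 fun _ : Fin (n + m + 2) => EuclideanSpace ℝ (Fin N) :=
    fun t => responseVec A (n + m + 2) t i
  set w : Fin (n + 2) → PiLp 2 fun _ : Fin (n + m + 2) => EuclideanSpace ℝ (Fin N) :=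
    fun t => lagVec A m n j t
  have ha : ∀ z, ∑ t, ⟪a t, z⟫ ^ 2 ≤ (1 / D) ^ 2 * ‖z‖ ^ 2 := by
    intro z
    have := sum_sq_inner_responseVec_le hA hρ (n + m + 2) (n + 2) 0 (by omega) i z
    rwa [Finset.sum_range] at this
  have hF : ∑ t, ‖a t‖ ^ 2 ≤ τ * (1 / D) ^ 2 := by
    calc ∑ t, ‖a t‖ ^ 2 ≤ ∑ t : Fin (n + 2), (1 / D) ^ 2 := by
          refine Finset.sum_le_sum fun t _ => pow_le_pow_left₀ (norm_nonneg _) ?_ 2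
          exact norm_responseVec_le hA hρ (by omega) i
      _ = (n + 2) * (1 / D) ^ 2 := by simp
      _ ≤ _ := by gcongr
  -- The Chernoff parameter is `r y D² / 8`. Its admissibility reduces to `r y ≤ n`, which follows
  -- from `2 r ≤ y`, `y² = τ` and `τ ≤ 2 n`.
  have hs : r * y * D ^ 2 / 8 * (1 / D * (2 / n * (1 / D))) ≤ 1 / 4 := by
    have : r * y * D ^ 2 / 8 * (1 / D * (2 / n * (1 / D))) = r * y / (4 * n) := by
      field_simp; ring
    rw [this, div_le_iff₀ (by positivity)]
    nlinarith
  have htail := measure_stdGaussian_abs_quadratic_ge_le a w (by positivity) (by positivity) ha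
    (sum_sq_inner_lagVec_le hA hρ m n (by omega) j) hF (by positivity) hs
    (16 * r / (D ^ 2 * y))
  have hbias := abs_bias_le hA hρ m n (by omega) i j
  rw [← sum_inner_responseVec_lagVec hA] at hbias
  have hbias2 : 4 / ((n : ℝ) + 2) * (1 / D) ≤ 8 / (D ^ 2 * y) := by
    rw [div_mul_div_comm, div_le_div_iff₀ (by positivity) (by positivity)]
    have h1 : D ^ 2 * y ≤ D * y := by
      apply mul_le_mul_of_nonneg_right _ (by positivity)
      nlinarith
    have h2 : y ≤ τ := by nlinarith
    have h3 : D * y ≤ D * (2 * (n + 2)) := mul_le_mul_of_nonneg_left (by linarith) hD.le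
    nlinarith
  refine (measureReal_mono ?_).trans (htail.trans ?_)
  · intro z hz
    rw [Set.mem_ofPred_eq] at hz ⊢
    rw [estimator_trajectory_apply] at hz
    have h1 := abs_sub_le (∑ t, ⟪a t, z⟫ * ⟪w t, z⟫) (∑ t, ⟪a t, w t⟫) ((A ^ m) i j)
    have h2 : 8 * (1 + 2 * r) / (D ^ 2 * y) = 16 * r / (D ^ 2 * y) + 8 / (D ^ 2 * y) := by
      rw [← add_div]; ring
    linarith
  -- The exponent is `-2 r² + r² (τ / n)² / 8`, at most `-3 r² / 2` since `τ ≤ 2 n`.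
  · gcongr
    have h1 : -(r * y * D ^ 2 / 8) * (16 * r / (D ^ 2 * y)) = -(2 * r ^ 2) := by
      field_simp; ring
    have h2 : 2 * (r * y * D ^ 2 / 8) ^ 2 * ((2 / n * (1 / D)) ^ 2 * (τ * (1 / D) ^ 2)) =
        r ^ 2 * (τ / n) ^ 2 / 8 := by
      rw [← hy2]
      field_simp
      ring
    have h3 : (τ / n) ^ 2 ≤ 2 ^ 2 :=
      pow_le_pow_left₀ (by positivity) ((div_le_iff₀ hn).2 hτn) 2
    rw [h1, h2]
    nlinarith [mul_le_mul_of_nonneg_left h3 (sq_nonneg r)]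

/-! ### Transfer to the given probability space. -/

lemma charFun_multivariateGaussian_zero_smul_one (σ : ℝ) (v : EuclideanSpace ℝ (Fin N)) :
    charFun (multivariateGaussian 0 (σ ^ 2 • (1 : Matrix (Fin N) (Fin N) ℝ))) v =
      Complex.exp (-(σ ^ 2 * ‖v‖ ^ 2) / 2) := by
  rw [charFun_multivariateGaussian (Matrix.PosSemidef.one.smul (sq_nonneg σ))]
  congr 1
  have : v.ofLp ⬝ᵥ (σ ^ 2 • (1 : Matrix (Fin N) (Fin N) ℝ)).mulVec v.ofLp = σ ^ 2 * ‖v‖ ^ 2 := by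
    rw [Matrix.smul_mulVec, Matrix.one_mulVec, dotProduct_smul, smul_eq_mul,
      EuclideanSpace.real_norm_sq_eq]
    simp [dotProduct, sq]
  rw [this]
  simp
  ring

variable {Ω : Type*} [MeasurableSpace Ω] {P : Measure Ω} {σ : ℝ}
  {ξ x : ℕ → Ω → EuclideanSpace ℝ (Fin N)}

lemma IsLinearDynamics.eq_trajectory (h : IsLinearDynamics P A σ ξ x) (t : ℕ) (ω : Ω) :
    x t ω = trajectory A (fun s => ξ s ω) t := by
  induction t with
  | zero => exact h.init ω
  | succ t ih => rw [h.step, ih, trajectory]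

variable [IsProbabilityMeasure P]

/-- Independence factors the characteristic function, and the factors `exp (-σ² ‖v s‖² / 2)`
multiply to that of a scaled standard Gaussian. -/
lemma IsLinearDynamics.map_noise (h : IsLinearDynamics P A σ ξ x) (L : ℕ) :
    P.map (fun ω => (WithLp.toLp 2 fun s : Fin L => ξ s ω :
        PiLp 2 fun _ : Fin L => EuclideanSpace ℝ (Fin N))) =
      (stdGaussian (PiLp 2 fun _ : Fin L => EuclideanSpace ℝ (Fin N))).map (fun z => σ • z) := by
  have hae : ∀ s : Fin L, AEMeasurable (ξ s) P := fun s => (h.law s).aemeasurable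
  have hae' : AEMeasurable (fun ω => (WithLp.toLp 2 fun s : Fin L => ξ s ω :
        PiLp 2 fun _ : Fin L => EuclideanSpace ℝ (Fin N))) P := by fun_prop
  have := Measure.isProbabilityMeasure_map hae'
  have : IsProbabilityMeasure
      ((stdGaussian (PiLp 2 fun _ : Fin L => EuclideanSpace ℝ (Fin N))).map (fun z => σ • z)) :=
    Measure.isProbabilityMeasure_map (by fun_prop)
  apply Measure.ext_of_charFun
  ext v
  rw [(iIndepFun_iff_charFun_pi hae).1 (h.indep.precomp Fin.val_injective) v, charFun_map_smul,
    charFun_stdGaussian]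
  simp_rw [(h.law _).map_eq, charFun_multivariateGaussian_zero_smul_one]
  rw [← Complex.exp_sum, ← Finset.sum_div, Finset.sum_neg_distrib, ← Finset.mul_sum, norm_smul,
    Real.norm_eq_abs, Complex.ofReal_mul, mul_pow, ← Complex.ofReal_pow ‖v‖]
  rw [PiLp.norm_sq_eq_of_L2]
  have : ((|σ| : ℝ) : ℂ) ^ 2 = (σ : ℂ) ^ 2 := by
    rw [← Complex.ofReal_pow, sq_abs, Complex.ofReal_pow]
  rw [this]
  push_cast
  rfl

lemma estimator_congr {m n : ℕ} {x y : ℕ → EuclideanSpace ℝ (Fin N)}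
    (h : ∀ t < n + m + 2, x t = y t) (i j : Fin N) :
    estimator m (n + m + 2) x i j = estimator m (n + m + 2) y i j := by
  rw [estimator_apply, estimator_apply]
  congr 2 <;> refine Finset.sum_congr rfl fun t ht => ?_ <;>
    have ht' := Finset.mem_range.1 ht <;>
    rw [h t (by omega), h _ (by omega)]

/-- The estimator is homogeneous of degree two in the noise, so scaling by `σ` multiplies the
unit-noise deviation by `σ ^ 2`. -/
lemma IsLinearDynamics.measure_estimator_deviation_le (h : IsLinearDynamics P A σ ξ x)
    (hA : A.IsSymm) (hρ : rho A < 1) (hσ : σ ≠ 0) (m n : ℕ)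
    (hmn : m + 2 ≤ n) (i j : Fin N) {r : ℝ} (hr : 0 ≤ r) (hrn : 2 * r ≤ √((n + m + 2 : ℕ) : ℝ)) :
    P.real {ω | σ ^ 2 * (8 * (1 + 2 * r) / ((1 - rho A) ^ 2 * √((n + m + 2 : ℕ) : ℝ))) <
        |estimator m (n + m + 2) (fun t => x t ω) i j - σ ^ 2 * (A ^ m) i j|} ≤
      2 * Real.exp (-r ^ 2) := by
  set B := 8 * (1 + 2 * r) / ((1 - rho A) ^ 2 * √((n + m + 2 : ℕ) : ℝ)) with hB
  set Z : Ω → PiLp 2 fun _ : Fin (n + m + 2) => EuclideanSpace ℝ (Fin N) :=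
    fun ω => WithLp.toLp 2 fun s => ξ s ω with hZ
  have hae : ∀ s : Fin (n + m + 2), AEMeasurable (ξ s) P := fun s => (h.law s).aemeasurable
  have hZm : AEMeasurable Z P := by fun_prop
  have hmeas : MeasurableSet {z : PiLp 2 fun _ : Fin (n + m + 2) => EuclideanSpace ℝ (Fin N) |
      σ ^ 2 * B < |estimator m (n + m + 2) (trajectory A (extendNoise z)) i j -
        σ ^ 2 * (A ^ m) i j|} := by
    simp_rw [estimator_trajectory_apply]
    exact measurableSet_lt measurable_const (by fun_prop)
  have hset : {ω | σ ^ 2 * B <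
      |estimator m (n + m + 2) (fun t => x t ω) i j - σ ^ 2 * (A ^ m) i j|} =
      Z ⁻¹' {z | σ ^ 2 * B < |estimator m (n + m + 2) (trajectory A (extendNoise z)) i j -
        σ ^ 2 * (A ^ m) i j|} := by
    ext ω
    rw [Set.mem_preimage, Set.mem_ofPred_eq, Set.mem_ofPred_eq]
    rw [estimator_congr (y := trajectory A (extendNoise (Z ω))) fun t ht => ?_]
    rw [h.eq_trajectory]
    refine trajectory_congr fun s hs => ?_
    simp [extendNoise, hZ, show s < n + m + 2 by omega]
  rw [hset, ← map_measureReal_apply_of_aemeasurable hZm hmeas, h.map_noise,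
    map_measureReal_apply (by fun_prop) hmeas]
  refine le_trans (measureReal_mono fun z hz => ?_)
    (measure_stdGaussian_estimator_deviation_le hA hρ m n hmn i j hr hrn)
  rw [Set.mem_preimage, Set.mem_ofPred_eq] at hz
  rw [Set.mem_ofPred_eq]
  have hσ2 : 0 < σ ^ 2 := by positivity
  rw [estimator_trajectory_apply] at hz ⊢
  have hsc : ∑ t : Fin (n + 2), ⟪responseVec A (n + m + 2) t i, σ • z⟫ * ⟪lagVec A m n j t, σ • z⟫ =
      σ ^ 2 * ∑ t : Fin (n + 2), ⟪responseVec A (n + m + 2) t i, z⟫ * ⟪lagVec A m n j t, z⟫ := by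
    rw [Finset.mul_sum]
    refine Finset.sum_congr rfl fun t _ => ?_
    rw [real_inner_smul_right, real_inner_smul_right]
    ring
  rw [hsc, ← mul_sub, abs_mul, abs_of_pos hσ2] at hz
  exact lt_of_mul_lt_mul_left hz hσ2.le

lemma maxNorm_le_iff {M : Matrix (Fin N) (Fin N) ℝ} {ε : ℝ} (hε : 0 ≤ ε) :
    maxNorm M ≤ ε ↔ ∀ i j, |M i j| ≤ ε := by
  let := Matrix.normedAddCommGroup (m := Fin N) (n := Fin N) (α := ℝ)
  exact Matrix.norm_le_iff hε

lemma one_sub_le_measureReal_of_compl {s : Set Ω} {δ : ℝ} (h : P.real sᶜ ≤ δ) :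
    1 - δ ≤ P.real s := by
  have h1 := measureReal_union_le (μ := P) s sᶜ
  rw [Set.union_compl_self, probReal_univ] at h1
  linarith

theorem IsLinearDynamics.finite_sample_bound (h : IsLinearDynamics P A σ ξ x)
    (hA : A.IsSymm) (hρ : rho A < 1) (m T : ℕ) (ε δ : ℝ) (hε : 0 < ε)
    (hεσ : ε < 4 * σ ^ 2 / (1 - rho A) ^ 2) (hδ : 0 < δ)
    (hT : max (64 * σ ^ 4 * (1 + 2 * √(Real.log (2 * (N : ℝ) ^ 2 / δ))) ^ 2 /
            (ε ^ 2 * (1 - rho A) ^ 4)) (2 * ((m : ℝ) + 2)) ≤ (T : ℝ)) :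
    1 - δ ≤ P.real {ω | maxNorm (estimator m T (fun t => x t ω) - σ ^ 2 • A ^ m) ≤ ε} := by
  -- Discarding `δ ≥ 1` makes the logarithm nonnegative once `N ≥ 1`, so the square root below
  -- really squares back to it.
  rcases le_or_gt 1 δ with hδ1 | hδ1
  · exact (sub_nonpos.2 hδ1).trans measureReal_nonneg
  have hD : 0 < 1 - rho A := by linarith
  obtain ⟨hT1, hT2⟩ := max_le_iff.1 hT
  have hσ : σ ≠ 0 := by
    rintro rfl
    simp at hεσ
    linarith
  have hσ2 : 0 < σ ^ 2 := by positivity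
  have hT3 : 2 * (m + 2) ≤ T := by exact_mod_cast hT2
  obtain ⟨n, rfl⟩ : ∃ n, T = n + m + 2 := ⟨T - m - 2, by omega⟩
  apply one_sub_le_measureReal_of_compl
  rcases Nat.eq_zero_or_pos N with rfl | hN
  · have : {ω | maxNorm (estimator m (n + m + 2) (fun t => x t ω) - σ ^ 2 • A ^ m) ≤ ε}ᶜ = ∅ := by
      rw [Set.compl_empty_iff, Set.eq_univ_iff_forall]
      exact fun ω => (maxNorm_le_iff hε.le).2 fun i => i.elim0
    rw [this, measureReal_empty]
    exact hδ.le
  have hN1 : (1 : ℝ) ≤ N := by exact_mod_cast hN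
  set D := 1 - rho A with hDdef
  set r := √(Real.log (2 * (N : ℝ) ^ 2 / δ)) with hrdef
  have hr : 0 ≤ r := Real.sqrt_nonneg _
  have hr2 : r ^ 2 = Real.log (2 * (N : ℝ) ^ 2 / δ) := by
    refine Real.sq_sqrt (Real.log_nonneg ?_)
    rw [le_div_iff₀ hδ]
    nlinarith
  set y := √((n + m + 2 : ℕ) : ℝ) with hy
  have hypos : 0 < y := Real.sqrt_pos.2 (by positivity)
  have hy1 : 8 * σ ^ 2 * (1 + 2 * r) / (ε * D ^ 2) ≤ y := by
    apply Real.le_sqrt_of_sq_le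
    refine le_trans (le_of_eq ?_) hT1
    rw [div_pow]
    congr 1 <;> ring
  rw [div_le_iff₀ (by positivity)] at hy1
  have hεD : ε * D ^ 2 < 4 * σ ^ 2 := by rwa [lt_div_iff₀ (by positivity)] at hεσ
  -- The upper bound on `ε` enters here: it keeps `r` in the sub-Gaussian range of the Chernoff
  -- bound.
  have hry : 2 * r ≤ y := by
    have h1 : y * (ε * D ^ 2) ≤ y * (4 * σ ^ 2) := mul_le_mul_of_nonneg_left hεD.le hypos.le
    have h2 : (2 * (1 + 2 * r)) * (4 * σ ^ 2) ≤ y * (4 * σ ^ 2) := by linarith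
    linarith [le_of_mul_le_mul_right h2 (by positivity)]
  have hB : σ ^ 2 * (8 * (1 + 2 * r) / (D ^ 2 * y)) ≤ ε := by
    rw [← mul_div_assoc, div_le_iff₀ (by positivity)]
    linarith
  have hsub : {ω | maxNorm (estimator m (n + m + 2) (fun t => x t ω) - σ ^ 2 • A ^ m) ≤ ε}ᶜ ⊆
      ⋃ p : Fin N × Fin N, {ω | σ ^ 2 * (8 * (1 + 2 * r) / (D ^ 2 * y)) <
        |estimator m (n + m + 2) (fun t => x t ω) p.1 p.2 - σ ^ 2 * (A ^ m) p.1 p.2|} := by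
    intro ω hω
    rw [Set.mem_compl_iff, Set.mem_ofPred_eq, maxNorm_le_iff hε.le] at hω
    push Not at hω
    obtain ⟨i, j, hij⟩ := hω
    exact Set.mem_iUnion.2 ⟨(i, j), hB.trans_lt hij⟩
  refine (measureReal_mono hsub).trans ((measureReal_iUnion_fintype_le _).trans ?_)
  refine (Finset.sum_le_sum fun p _ =>
    h.measure_estimator_deviation_le hA hρ hσ m n (by omega) p.1 p.2 hr hry).trans ?_
  rw [Finset.sum_const, Finset.card_univ, Fintype.card_prod, Fintype.card_fin, nsmul_eq_mul,
    hr2, Real.exp_neg, Real.exp_log (by positivity)]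
  push_cast
  apply le_of_eq
  field_simp

/-! ### Logarithmic sample complexity and conclusion. -/

/-- Recovery from `O(log N)` observations, with noise level factored out. -/
theorem exists_sample_complexity (m : ℕ) {r ε δ : ℝ} (hr : r < 1) (hε : 0 < ε) (hδ : 0 < δ) :
    ∃ C : ℝ, ∀ N : ℕ, 2 ≤ N → ∀ ρ : ℝ, ρ ≤ r → ∀ T : ℕ, C * Real.log N ≤ T →
      max (64 * (1 + 2 * √(Real.log (2 * (N : ℝ) ^ 2 / δ))) ^ 2 / (ε ^ 2 * (1 - ρ) ^ 4))
        (2 * ((m : ℝ) + 2)) ≤ T := by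
  have hlog2 : 0 < Real.log 2 := Real.log_pos one_lt_two
  set c := Real.log 2 + |Real.log δ| with hc
  have hc0 : 0 ≤ c := by positivity
  have hr1 : 0 < 1 - r := by linarith
  set K := 64 / (ε ^ 2 * (1 - r) ^ 4) with hK
  have hK0 : 0 < K := by positivity
  -- From `(1 + 2q)² ≤ 2 + 8q²`, with constants absorbed through `1 ≤ log N / log 2`; the last
  -- summand secures `T ≥ 2 (m + 2)`.
  refine ⟨K * (2 / Real.log 2 + 8 * (2 + c / Real.log 2)) + 2 * (m + 2) / Real.log 2,
    fun N hN ρ hρ T hT => ?_⟩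
  have hN2 : (2 : ℝ) ≤ N := by exact_mod_cast hN
  have hlogN : Real.log 2 ≤ Real.log N := Real.log_le_log two_pos hN2
  have hratio : ∀ a : ℝ, 0 ≤ a → a ≤ a / Real.log 2 * Real.log N := fun a ha => by
    rw [div_mul_eq_mul_div, le_div_iff₀ hlog2]
    exact mul_le_mul_of_nonneg_left hlogN ha
  have hm := hratio (2 * (m + 2)) (by positivity)
  have h2 := hratio 2 zero_le_two
  have hcN := hratio c hc0
  have hNpos : (0 : ℝ) < N := by linarith
  have hlogpos : 0 < Real.log N := by linarith
  have hL : Real.log (2 * (N : ℝ) ^ 2 / δ) ≤ (2 + c / Real.log 2) * Real.log N := by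
    rw [Real.log_div (by positivity) hδ.ne', Real.log_mul two_ne_zero (by positivity),
      Real.log_pow]
    push_cast
    linarith [neg_abs_le (Real.log δ)]
  have hsq : (1 + 2 * √(Real.log (2 * (N : ℝ) ^ 2 / δ))) ^ 2 ≤
      (2 / Real.log 2 + 8 * (2 + c / Real.log 2)) * Real.log N := by
    have h3 := Real.sqrt_le_sqrt hL
    have h4 : 0 ≤ (2 + c / Real.log 2) * Real.log N := by positivity
    have h5 := Real.sq_sqrt h4
    set q := √((2 + c / Real.log 2) * Real.log N)
    have h6 : (1 + 2 * √(Real.log (2 * (N : ℝ) ^ 2 / δ))) ^ 2 ≤ (1 + 2 * q) ^ 2 :=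
      pow_le_pow_left₀ (by positivity) (by linarith) 2
    nlinarith [sq_nonneg (1 - 2 * q)]
  refine max_le ?_ ?_
  · calc _ ≤ K * (1 + 2 * √(Real.log (2 * (N : ℝ) ^ 2 / δ))) ^ 2 := by
          rw [hK, div_mul_eq_mul_div]
          gcongr
      _ ≤ K * ((2 / Real.log 2 + 8 * (2 + c / Real.log 2)) * Real.log N) := by gcongr
      _ ≤ _ := by
          refine le_trans ?_ hT
          have : 0 ≤ 2 * ((m : ℝ) + 2) / Real.log 2 * Real.log N := by positivity
          linarith
  · refine hm.trans (le_trans ?_ hT)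
    have : 0 ≤ K * (2 / Real.log 2 + 8 * (2 + c / Real.log 2)) * Real.log N := by positivity
    linarith

end Estimator

theorem theorem2 :
    -- the finite-sample bound
    (∀ (N : ℕ) (A : Matrix (Fin N) (Fin N) ℝ) (σ : ℝ) (Ω : Type*) [MeasurableSpace Ω]
        (P : Measure Ω) [IsProbabilityMeasure P] (ξ x : ℕ → Ω → EuclideanSpace ℝ (Fin N)),
      A.IsSymm → rho A < 1 → IsLinearDynamics P A σ ξ x →
      ∀ (m T : ℕ) (ε δ : ℝ), 0 < ε → ε < 4 * σ ^ 2 / (1 - rho A) ^ 2 → 0 < δ →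
        max (64 * σ ^ 4 * (1 + 2 * √(Real.log (2 * (N : ℝ) ^ 2 / δ))) ^ 2 /
            (ε ^ 2 * (1 - rho A) ^ 4)) (2 * ((m : ℝ) + 2)) ≤ (T : ℝ) →
        1 - δ ≤ P.real {ω | maxNorm (estimator m T (fun t => x t ω) - σ ^ 2 • A ^ m) ≤ ε}) ∧
    -- `T = O(log N)` observations suffice to recover `A` (take `m = 1`) and its powers
    (∀ (m : ℕ) (r ε δ : ℝ), r < 1 → 0 < ε → 0 < δ → ∃ C : ℝ,
      ∀ (N : ℕ) (A : Matrix (Fin N) (Fin N) ℝ) (σ : ℝ) (Ω : Type*) [MeasurableSpace Ω]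
        (P : Measure Ω) [IsProbabilityMeasure P] (ξ x : ℕ → Ω → EuclideanSpace ℝ (Fin N)),
      2 ≤ N → 0 < σ → A.IsSymm → rho A ≤ r → IsLinearDynamics P A σ ξ x →
      ∀ T : ℕ, C * Real.log N ≤ (T : ℝ) →
        1 - δ ≤ P.real
          {ω | maxNorm ((σ ^ 2)⁻¹ • estimator m T (fun t => x t ω) - A ^ m) ≤ ε}) := by
  refine ⟨fun N A σ Ω _ P _ ξ x hA hρ h m T ε δ hε hεσ hδ hT =>
    h.finite_sample_bound hA hρ m T ε δ hε hεσ hδ hT, fun m r ε δ hr hε hδ => ?_⟩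
  -- Capping the accuracy at `2` meets the upper bound on `ε` for every `A`, because `(1 - ρ)² ≤ 1`;
  -- the factor `σ ^ 2` used below cancels the noise level from the sample size.
  have hε' : 0 < min ε 2 := lt_min hε two_pos
  obtain ⟨C, hC⟩ := exists_sample_complexity m hr hε' hδ
  refine ⟨C, fun N A σ Ω _ P _ ξ x hN hσ hA hρ h T hT => ?_⟩
  have hσ2 : 0 < σ ^ 2 := by positivity
  have h0 := rho_nonneg A
  have hD : 0 < 1 - rho A := by linarith
  have hb := h.finite_sample_bound hA (hρ.trans_lt hr) m T (σ ^ 2 * min ε 2) δ (by positivity)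
    (by
      rw [lt_div_iff₀ (by positivity)]
      have h1 : (1 - rho A) ^ 2 ≤ 1 := pow_le_one₀ hD.le (by linarith)
      have h2 : min ε 2 * (1 - rho A) ^ 2 ≤ 2 * 1 :=
        mul_le_mul (min_le_right _ _) h1 (by positivity) zero_le_two
      nlinarith) hδ
    (by
      convert hC N hN (rho A) hρ T hT using 2
      field_simp)
  refine hb.trans (measureReal_mono fun ω hω => ?_)
  rw [Set.mem_ofPred_eq, maxNorm_le_iff (by positivity)] at hω
  rw [Set.mem_ofPred_eq, maxNorm_le_iff hε.le]
  intro i j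
  have hij := hω i j
  simp only [Matrix.sub_apply, Matrix.smul_apply, smul_eq_mul] at hij ⊢
  have : (σ ^ 2)⁻¹ * estimator m T (fun t => x t ω) i j - (A ^ m) i j =
      (σ ^ 2)⁻¹ * (estimator m T (fun t => x t ω) i j - σ ^ 2 * (A ^ m) i j) := by
    field_simp
  rw [this, abs_mul, abs_of_pos (inv_pos.2 hσ2), inv_mul_le_iff₀ hσ2]
  exact hij.trans (mul_le_mul_of_nonneg_left (min_le_left _ _) hσ2.le)
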